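/- Let $H=\{(\tau,\nu,\phi):\tau,\nu,\phi\in\mathbb R\}$ be the Heisenberg--Weyl group, with the topology of $\mathbb R^3$ and the multiplication $$(\tau_1,\nu_1,\phi_1)\cdot(\tau_2,\nu_2,\phi_2)=(\tau_1+\tau_2,\ \nu_1+\nu_2,\ \phi_1+\phi_2-2\pi\tau_1\nu_2),$$ and let $\rho$ be its Schrödinger representation on $L^2(\mathbb R)$ (complex-valued functions), $$(\rho(\tau,\nu,\phi)x)(t)=e^{i\phi}e^{i2\pi\nu t}x(t-\tau),$$ a strongly continuous unitary representation. Inner products are linear in the first argument. The center of $H$ is $Z=\{(0,0,\phi):\phi\in\mathbb R\}$, and $d\tau\,d\nu\,d\phi$ is a left and right Haar measure on $H$. A unitary representation $\pi$ of $H$ on a Hilbert space $\mathcal H$ is *square-integrable* if there is a nonzero $\psi\in\mathcal H$ (an *admissible* vector) with $\int_H|\langle\pi(g)\psi,\psi\rangle|^2\,d\mu(g)<\infty$, where $\mu$ is a Haar measure on $H$. Square-integrability and admissibility *modulo $Z$* are defined in the same way, with $|\langle\pi(g)\psi,\psi\rangle|^2$ regarded as a function on $H/Z$ and integrated over $H/Z$.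 Then: 1. $\rho$ is irreducible, with central character $e^{i\phi}$, that is, $\rho(0,0,\phi)=e^{i\phi}I$ for all $\phi$. Every irreducible strongly continuous unitary representation of $H$ on a complex Hilbert space with this central character is unitarily equivalent to $\rho$. 2. $\rho$ is not square-integrable over $H$. 3. $\rho$ is square-integrable modulo $Z$. The map $(\tau,\nu,\phi)Z\mapsto(\tau,\nu)$ is an isomorphism of topological groups $H/Z\cong\mathbb R^2$; equip $H/Z$ with the measure $d\tau\,d\nu$. Every nonzero $\psi\in L^2(\mathbb R)$ is admissible modulo $Z$. For all $x,\psi\in L^2(\mathbb R)$, with $V_\psi x(\tau,\nu)=\langle x,\rho(\tau,\nu,0)\psi\rangle$, the function $|V_\psi x|^2$ is integrable and the Moyal identity holds: $$\int_{\mathbb R^2}|V_\psi x(\tau,\nu)|^2\,d\tau\,d\nu=\|x\|^2\|\psi\|^2 .$$ 4. The measure $d\tau\,d\nu$ is a left and right Haar measure on $H/Z$, and the Duflo--Moore operator of $\rho$ on $H/Z$ is the identity. That is, $C=I$ (with domain all of $L^2(\mathbb R)$) is the unique positive self-adjoint densely defined operator $C$ on $L^2(\mathbb R)$ such that, for all $\psi_1,\psi_2\in\mathrm{Dom}(C)$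 and all $\varphi_1,\varphi_2\in L^2(\mathbb R)$, the function $\langle\rho(g)\psi_1,\varphi_1\rangle\overline{\langle\rho(g)\psi_2,\varphi_2\rangle}$ descends to an integrable function on $H/Z$ and $$\int_{H/Z}\langle\rho(g)\psi_1,\varphi_1\rangle\,\overline{\langle\rho(g)\psi_2,\varphi_2\rangle}\,d\tau\,d\nu=\langle C\psi_1,C\psi_2\rangle\,\langle\varphi_2,\varphi_1\rangle .$$ -/

import Mathlib

open MeasureTheory
open scoped ENNReal

/-! ### Unitary representations, square-integrability, Duflo-Moore operators -/

/-- A unitary representation of a topological group `G` on a complex Hilbert space `K`: a group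
homomorphism into the unitary group of `K` that is strongly continuous. -/
structure UnitaryRep (G : Type*) [Group G] [TopologicalSpace G]
    (K : Type*) [NormedAddCommGroup K] [InnerProductSpace ℂ K] where
  toHom : G →* (K ≃ₗᵢ[ℂ] K)
  strongly_continuous : ∀ v : K, Continuous fun g => toHom g v

namespace UnitaryRep

variable {G : Type*} [Group G] [TopologicalSpace G]
variable {K : Type*} [NormedAddCommGroup K] [InnerProductSpace ℂ K]
variable {K' : Type*} [NormedAddCommGroup K'] [InnerProductSpace ℂ K']

instance : CoeFun (UnitaryRep G K) fun _ => G → K ≃ₗᵢ[ℂ] K := ⟨fun ρ => ρ.toHom⟩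

/-- `K` is nonzero and its only closed invariant subspaces are `0` and `K`. -/
def IsIrreducible (ρ : UnitaryRep G K) : Prop :=
  Nontrivial K ∧ ∀ W : Submodule ℂ K, IsClosed (W : Set K) →
    (∀ g, ∀ v ∈ W, ρ g v ∈ W) → W = ⊥ ∨ W = ⊤

/-- Unitary equivalence of unitary representations. -/
def IsEquivalent (ρ : UnitaryRep G K) (ρ' : UnitaryRep G K') : Prop :=
  ∃ U : K ≃ₗᵢ[ℂ] K', ∀ g v, U (ρ g v) = ρ' g (U v)

/-- `ψ` is an admissible vector: `ψ ≠ 0` and `∫_G |⟨ρ(g)ψ, ψ⟩|² dμ(g) < ∞`. -/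
def IsAdmissible [MeasurableSpace G] (ρ : UnitaryRep G K) (μ : Measure G) (ψ : K) : Prop :=
  ψ ≠ 0 ∧ ∫⁻ g, ‖inner ℂ (ρ g ψ) ψ‖ₑ ^ 2 ∂μ < ∞

/-- `ρ` is square-integrable (with respect to the Haar measure `μ`). -/
def IsSquareIntegrable [MeasurableSpace G] (ρ : UnitaryRep G K) (μ : Measure G) : Prop :=
  ∃ ψ, ρ.IsAdmissible μ ψ

/-- `ψ` is admissible modulo the center `Z`: `ψ ≠ 0`, the function `|⟨ρ(g)ψ, ψ⟩|²` descends to a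
function `f` on `G ⧸ Z`, and its integral over `G ⧸ Z` is finite. -/
def IsAdmissibleModCenter [MeasurableSpace G] (ρ : UnitaryRep G K)
    (μ : Measure (G ⧸ Subgroup.center G)) (ψ : K) : Prop :=
  ψ ≠ 0 ∧ ∃ f : G ⧸ Subgroup.center G → ℝ≥0∞,
    (∀ g : G, f g = ‖inner ℂ (ρ g ψ) ψ‖ₑ ^ 2) ∧ ∫⁻ q, f q ∂μ < ∞

/-- `ρ` is square-integrable modulo the center. -/
def IsSquareIntegrableModCenter [MeasurableSpace G] (ρ : UnitaryRep G K)
    (μ : Measure (G ⧸ Subgroup.center G)) : Prop :=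
  ∃ ψ, ρ.IsAdmissibleModCenter μ ψ

/-- `C` is a Duflo-Moore operator of `ρ` on `G ⧸ Z`: a densely defined, self-adjoint, positive
(possibly unbounded) operator such that for all `ψ₁, ψ₂` in its domain and all `φ₁, φ₂`,
`∫_{G/Z} ⟨ρ(g)ψ₁, φ₁⟩ conj ⟨ρ(g)ψ₂, φ₂⟩ dμ = ⟨C ψ₁, C ψ₂⟩ ⟨φ₂, φ₁⟩`
for the inner product that is linear in its first argument, i.e. `⟨a, b⟩ = inner ℂ b a`.
The integrand is required to descend to an integrable function `f` on `G ⧸ Z`. -/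
def IsDufloMooreModCenter [MeasurableSpace G] [CompleteSpace K] (ρ : UnitaryRep G K)
    (μ : Measure (G ⧸ Subgroup.center G)) (C : K →ₗ.[ℂ] K) : Prop :=
  Dense (C.domain : Set K) ∧ IsSelfAdjoint C ∧
  (∀ v : C.domain, 0 ≤ (inner ℂ (v : K) (C v)).re) ∧
  ∀ (ψ₁ ψ₂ : C.domain) (φ₁ φ₂ : K), ∃ f : G ⧸ Subgroup.center G → ℂ,
    (∀ g : G, f g = inner ℂ φ₁ (ρ g ψ₁) * (starRingEnd ℂ) (inner ℂ φ₂ (ρ g ψ₂))) ∧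
    Integrable f μ ∧
    ∫ q, f q ∂μ = inner ℂ (C ψ₂) (C ψ₁) * inner ℂ φ₁ φ₂

end UnitaryRep

/-! ### The Heisenberg-Weyl group -/

/-- The Heisenberg-Weyl group: triples `(τ, ν, φ)` of real numbers. -/
@[ext]
structure HeisenbergWeyl where
  τ : ℝ
  ν : ℝ
  φ : ℝ

namespace HeisenbergWeyl

/-- The group law that makes `e^{iφ} e^{2πiνt} x(t - τ)` a representation. -/
noncomputable instance : Mul HeisenbergWeyl :=
  ⟨fun g h => ⟨g.τ + h.τ, g.ν + h.ν, g.φ + h.φ - 2 * Real.pi * g.τ * h.ν⟩⟩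

instance : One HeisenbergWeyl := ⟨⟨0, 0, 0⟩⟩

noncomputable instance : Inv HeisenbergWeyl := ⟨fun g => ⟨-g.τ, -g.ν, -g.φ - 2 * Real.pi * g.τ * g.ν⟩⟩

@[simp] lemma mul_τ (g h : HeisenbergWeyl) : (g * h).τ = g.τ + h.τ := rfl
@[simp] lemma mul_ν (g h : HeisenbergWeyl) : (g * h).ν = g.ν + h.ν := rfl
@[simp] lemma mul_φ (g h : HeisenbergWeyl) :
    (g * h).φ = g.φ + h.φ - 2 * Real.pi * g.τ * h.ν := rfl
@[simp] lemma one_τ : (1 : HeisenbergWeyl).τ = 0 := rfl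
@[simp] lemma one_ν : (1 : HeisenbergWeyl).ν = 0 := rfl
@[simp] lemma one_φ : (1 : HeisenbergWeyl).φ = 0 := rfl
@[simp] lemma inv_τ (g : HeisenbergWeyl) : (g⁻¹).τ = -g.τ := rfl
@[simp] lemma inv_ν (g : HeisenbergWeyl) : (g⁻¹).ν = -g.ν := rfl
@[simp] lemma inv_φ (g : HeisenbergWeyl) :
    (g⁻¹).φ = -g.φ - 2 * Real.pi * g.τ * g.ν := rfl

noncomputable instance : Group HeisenbergWeyl :=
  Group.ofLeftAxioms
    (fun a b c => by ext <;> simp <;> ring)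
    (fun a => by ext <;> simp)
    (fun a => by ext <;> simp; ring)

/-- Coordinates on the group. -/
def coords : HeisenbergWeyl ≃ ℝ × ℝ × ℝ where
  toFun g := (g.τ, g.ν, g.φ)
  invFun p := ⟨p.1, p.2.1, p.2.2⟩
  left_inv _ := rfl
  right_inv _ := rfl

/-- The topology of `ℝ³`. -/
instance : TopologicalSpace HeisenbergWeyl := TopologicalSpace.induced coords inferInstance

/-- The Borel σ-algebra of `ℝ³`. -/
instance : MeasurableSpace HeisenbergWeyl := MeasurableSpace.comap coords inferInstance

instance : BorelSpace HeisenbergWeyl := ⟨by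
  have h : (inferInstance : MeasurableSpace (ℝ × ℝ × ℝ)) = borel _ := BorelSpace.measurable_eq
  change MeasurableSpace.comap coords _ = _
  rw [h, borel_comap]⟩

/-- Coordinates as a homeomorphism. -/
def coordsHomeo : HeisenbergWeyl ≃ₜ ℝ × ℝ × ℝ := coords.toHomeomorphOfIsInducing ⟨rfl⟩

instance : SecondCountableTopology HeisenbergWeyl :=
  coordsHomeo.isEmbedding.secondCountableTopology

instance : T2Space HeisenbergWeyl := coordsHomeo.isEmbedding.t2Space

instance : LocallyCompactSpace HeisenbergWeyl :=
  coordsHomeo.isClosedEmbedding.locallyCompactSpace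

lemma continuous_τ : Continuous HeisenbergWeyl.τ :=
  continuous_fst.comp coordsHomeo.continuous
lemma continuous_ν : Continuous HeisenbergWeyl.ν :=
  (continuous_fst.comp continuous_snd).comp coordsHomeo.continuous
lemma continuous_φ : Continuous HeisenbergWeyl.φ :=
  (continuous_snd.comp continuous_snd).comp coordsHomeo.continuous

lemma continuous_mk {X : Type*} [TopologicalSpace X] {a b c : X → ℝ} (ha : Continuous a)
    (hb : Continuous b) (hc : Continuous c) :
    Continuous fun x => (⟨a x, b x, c x⟩ : HeisenbergWeyl) :=
  coordsHomeo.symm.continuous.comp (ha.prodMk (hb.prodMk hc))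

instance : IsTopologicalGroup HeisenbergWeyl where
  continuous_mul := by
    have h1 := continuous_τ.comp (continuous_fst (X := HeisenbergWeyl) (Y := HeisenbergWeyl))
    have h2 := continuous_ν.comp (continuous_fst (X := HeisenbergWeyl) (Y := HeisenbergWeyl))
    have h3 := continuous_φ.comp (continuous_fst (X := HeisenbergWeyl) (Y := HeisenbergWeyl))
    have k1 := continuous_τ.comp (continuous_snd (X := HeisenbergWeyl) (Y := HeisenbergWeyl))
    have k2 := continuous_ν.comp (continuous_snd (X := HeisenbergWeyl) (Y := HeisenbergWeyl))
    have k3 := continuous_φ.comp (continuous_snd (X := HeisenbergWeyl) (Y := HeisenbergWeyl))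
    exact continuous_mk (h1.add k1) (h2.add k2)
      ((h3.add k3).sub ((continuous_const.mul h1).mul k2))
  continuous_inv := continuous_mk continuous_τ.neg continuous_ν.neg
    (continuous_φ.neg.sub ((continuous_const.mul continuous_τ).mul continuous_ν))

/-- The measure `dτ dν dφ`. -/
noncomputable def haar : Measure HeisenbergWeyl := Measure.map coords.symm volume

/-- The measure `dτ dν` on `H ⧸ Z`, carried over from `ℝ²` by `(τ, ν) ↦ (τ, ν, 0) Z`. -/
noncomputable def haarModCenter : Measure (HeisenbergWeyl ⧸ Subgroup.center HeisenbergWeyl) :=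
  Measure.map (fun p : ℝ × ℝ => ((⟨p.1, p.2, 0⟩ : HeisenbergWeyl) :
    HeisenbergWeyl ⧸ Subgroup.center HeisenbergWeyl)) volume

/-- `π` has central character `e^{iφ}`: the element `(0, 0, φ)` acts as the scalar `e^{iφ}`. -/
def HasCentralCharacter {K : Type*} [NormedAddCommGroup K] [InnerProductSpace ℂ K]
    (π : UnitaryRep HeisenbergWeyl K) : Prop :=
  ∀ (φ : ℝ) (v : K), π ⟨0, 0, φ⟩ v = Complex.exp (Complex.I * φ) • v

/-! ### The Schrödinger representation -/

/-- The Hilbert space `L²(ℝ)` of complex-valued functions. -/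
abbrev L2R : Type := Lp ℂ 2 (volume : Measure ℝ)

/-- The function `t ↦ e^{iφ} e^{i2πνt} x(t - τ)`. -/
noncomputable def schrodingerFun (g : HeisenbergWeyl) (x : ℝ → ℂ) (t : ℝ) : ℂ :=
  Complex.exp (Complex.I * g.φ) * Complex.exp (Complex.I * (2 * Real.pi * g.ν * t)) * x (t - g.τ)

lemma norm_phase (g : HeisenbergWeyl) (t : ℝ) :
    ‖Complex.exp (Complex.I * g.φ) * Complex.exp (Complex.I * (2 * Real.pi * g.ν * t))‖ = 1 := by
  have h : Complex.I * (2 * Real.pi * g.ν * t) = ((2 * Real.pi * g.ν * t : ℝ) : ℂ) * Complex.I := by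
    push_cast; ring
  rw [norm_mul, h, mul_comm Complex.I, Complex.norm_exp_ofReal_mul_I,
    Complex.norm_exp_ofReal_mul_I, mul_one]

lemma norm_schrodingerFun (g : HeisenbergWeyl) (x : ℝ → ℂ) (t : ℝ) :
    ‖schrodingerFun g x t‖ = ‖x (t - g.τ)‖ := by
  rw [schrodingerFun, norm_mul, norm_phase, one_mul]

lemma schrodingerFun_congr (g : HeisenbergWeyl) {x y : ℝ → ℂ} (h : x =ᵐ[volume] y) :
    schrodingerFun g x =ᵐ[volume] schrodingerFun g y := by
  have := (measurePreserving_sub_right (volume : Measure ℝ) g.τ).quasiMeasurePreserving.ae_eq_comp h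
  filter_upwards [this] with t ht
  simp only [Function.comp] at ht
  simp only [schrodingerFun, ht]

lemma schrodingerFun_mul (g h : HeisenbergWeyl) (x : ℝ → ℂ) :
    schrodingerFun (g * h) x = schrodingerFun g (schrodingerFun h x) := by
  funext t
  simp only [schrodingerFun, mul_τ, mul_ν, mul_φ, ← mul_assoc, ← Complex.exp_add]
  congr 2
  · push_cast; ring_nf
  · ring

lemma eLpNorm_schrodingerFun (g : HeisenbergWeyl) {x : ℝ → ℂ}
    (hx : AEStronglyMeasurable x volume) :
    eLpNorm (schrodingerFun g x) 2 volume = eLpNorm x 2 volume := by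
  have h : eLpNorm (schrodingerFun g x) 2 volume =
      eLpNorm (x ∘ fun t => t - g.τ) 2 volume :=
    eLpNorm_congr_norm_ae (Filter.Eventually.of_forall fun t => norm_schrodingerFun g x t)
  rw [h, eLpNorm_comp_measurePreserving hx (measurePreserving_sub_right _ _)]

lemma memLp_schrodingerFun (g : HeisenbergWeyl) (x : L2R) :
    MemLp (schrodingerFun g x) 2 volume := by
  refine ⟨?_, by rw [eLpNorm_schrodingerFun g (Lp.aestronglyMeasurable x)]; exact Lp.eLpNorm_lt_top x⟩
  refine AEStronglyMeasurable.mul ?_ ?_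
  · exact (by fun_prop : Continuous fun t : ℝ => Complex.exp (Complex.I * g.φ) *
      Complex.exp (Complex.I * (2 * Real.pi * g.ν * t))).aestronglyMeasurable
  · exact (Lp.aestronglyMeasurable x).comp_measurePreserving (measurePreserving_sub_right _ g.τ)

/-- The operator `ρ(τ, ν, φ)` on `L²(ℝ)`: `(ρ(τ, ν, φ) x)(t) = e^{iφ} e^{i2πνt} x(t - τ)`. -/
noncomputable def schrodingerOp (g : HeisenbergWeyl) (x : L2R) : L2R :=
  (memLp_schrodingerFun g x).toLp (schrodingerFun g x)

lemma coeFn_schrodingerOp (g : HeisenbergWeyl) (x : L2R) :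
    schrodingerOp g x =ᵐ[volume] schrodingerFun g x := MemLp.coeFn_toLp _

lemma schrodingerOp_mul (g h : HeisenbergWeyl) (x : L2R) :
    schrodingerOp (g * h) x = schrodingerOp g (schrodingerOp h x) := by
  refine Lp.ext ?_
  refine (coeFn_schrodingerOp _ _).trans (.trans ?_ (coeFn_schrodingerOp _ _).symm)
  rw [schrodingerFun_mul]
  exact (schrodingerFun_congr g (coeFn_schrodingerOp h x)).symm

lemma schrodingerOp_one (x : L2R) : schrodingerOp 1 x = x := by
  refine Lp.ext ((coeFn_schrodingerOp _ _).trans (Filter.Eventually.of_forall fun t => ?_))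
  simp [schrodingerFun]

lemma schrodingerOp_add (g : HeisenbergWeyl) (x y : L2R) :
    schrodingerOp g (x + y) = schrodingerOp g x + schrodingerOp g y := by
  refine Lp.ext ?_
  filter_upwards [coeFn_schrodingerOp g (x + y), coeFn_schrodingerOp g x, coeFn_schrodingerOp g y,
    Lp.coeFn_add (schrodingerOp g x) (schrodingerOp g y),
    schrodingerFun_congr g (Lp.coeFn_add x y)] with t h1 h2 h3 h4 h5
  rw [h1, h4, h5, Pi.add_apply, h2, h3]
  simp only [schrodingerFun, Pi.add_apply, mul_add]

lemma schrodingerOp_smul (g : HeisenbergWeyl) (c : ℂ) (x : L2R) :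
    schrodingerOp g (c • x) = c • schrodingerOp g x := by
  refine Lp.ext ?_
  filter_upwards [coeFn_schrodingerOp g (c • x), coeFn_schrodingerOp g x,
    Lp.coeFn_smul c (schrodingerOp g x),
    schrodingerFun_congr g (Lp.coeFn_smul c x)] with t h1 h2 h4 h5
  rw [h1, h4, h5, Pi.smul_apply, h2]
  simp only [schrodingerFun, Pi.smul_apply, smul_eq_mul]
  ring

lemma norm_schrodingerOp (g : HeisenbergWeyl) (x : L2R) : ‖schrodingerOp g x‖ = ‖x‖ := by
  rw [Lp.norm_def, Lp.norm_def, eLpNorm_congr_ae (coeFn_schrodingerOp g x),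
    eLpNorm_schrodingerFun g (Lp.aestronglyMeasurable x)]

/-- `ρ(g)` as a unitary operator. -/
noncomputable def schrodingerUnitary (g : HeisenbergWeyl) : L2R ≃ₗᵢ[ℂ] L2R where
  toFun := schrodingerOp g
  invFun := schrodingerOp g⁻¹
  map_add' := schrodingerOp_add g
  map_smul' := schrodingerOp_smul g
  left_inv x := by rw [← schrodingerOp_mul, inv_mul_cancel, schrodingerOp_one]
  right_inv x := by rw [← schrodingerOp_mul, mul_inv_cancel, schrodingerOp_one]
  norm_map' := norm_schrodingerOp g

lemma continuous_inner_modulation (y z : L2R) :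
    Continuous fun g : HeisenbergWeyl => inner ℂ (schrodingerOp ⟨0, g.ν, g.φ⟩ y) z := by
  have key : ∀ g : HeisenbergWeyl, inner ℂ (schrodingerOp ⟨0, g.ν, g.φ⟩ y) z =
      ∫ t : ℝ, inner ℂ (Complex.exp (Complex.I * g.φ) *
        Complex.exp (Complex.I * (2 * Real.pi * g.ν * t)) * y t) (z t) := by
    intro g
    rw [L2.inner_def]
    refine integral_congr_ae ?_
    filter_upwards [coeFn_schrodingerOp ⟨0, g.ν, g.φ⟩ y] with t ht
    rw [ht]
    simp [schrodingerFun]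
  simp_rw [key]
  refine continuous_of_dominated (bound := fun t : ℝ => ‖y t‖ * ‖z t‖) ?_ ?_ ?_ ?_
  · intro g
    refine AEStronglyMeasurable.inner ?_ (Lp.aestronglyMeasurable z)
    refine AEStronglyMeasurable.mul ?_ (Lp.aestronglyMeasurable y)
    exact (by fun_prop : Continuous fun t : ℝ => Complex.exp (Complex.I * g.φ) *
      Complex.exp (Complex.I * (2 * Real.pi * g.ν * t))).aestronglyMeasurable
  · intro g
    refine Filter.Eventually.of_forall fun t => (norm_inner_le_norm _ _).trans ?_
    rw [norm_mul, norm_phase, one_mul]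
  · exact (Lp.memLp y).norm.integrable_mul (Lp.memLp z).norm
  · refine Filter.Eventually.of_forall fun t => ?_
    have h2 := continuous_ν
    have h3 := continuous_φ
    fun_prop

lemma continuous_modulation (y : L2R) :
    Continuous fun g : HeisenbergWeyl => schrodingerOp ⟨0, g.ν, g.φ⟩ y := by
  rw [continuous_iff_continuousAt]
  intro g₀
  rw [ContinuousAt, tendsto_iff_norm_sub_tendsto_zero]
  have h : Continuous fun g : HeisenbergWeyl =>
      √(‖y‖ ^ 2 - 2 * (inner ℂ (schrodingerOp ⟨0, g.ν, g.φ⟩ y)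
        (schrodingerOp ⟨0, g₀.ν, g₀.φ⟩ y)).re + ‖y‖ ^ 2) := by
    have := Complex.continuous_re.comp
      (continuous_inner_modulation y (schrodingerOp ⟨0, g₀.ν, g₀.φ⟩ y))
    exact Real.continuous_sqrt.comp ((continuous_const.sub (continuous_const.mul this)).add
      continuous_const)
  have e : ∀ g : HeisenbergWeyl, ‖schrodingerOp ⟨0, g.ν, g.φ⟩ y - schrodingerOp ⟨0, g₀.ν, g₀.φ⟩ y‖
      = √(‖y‖ ^ 2 - 2 * (inner ℂ (schrodingerOp ⟨0, g.ν, g.φ⟩ y)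
        (schrodingerOp ⟨0, g₀.ν, g₀.φ⟩ y)).re + ‖y‖ ^ 2) := by
    intro g
    have := norm_sub_sq (𝕜 := ℂ) (schrodingerOp ⟨0, g.ν, g.φ⟩ y) (schrodingerOp ⟨0, g₀.ν, g₀.φ⟩ y)
    rw [norm_schrodingerOp, norm_schrodingerOp] at this
    simp only [RCLike.re_eq_complex_re] at this
    rw [← this, Real.sqrt_sq (norm_nonneg _)]
  have h0 := h.tendsto g₀
  simp only [← e] at h0
  simpa using h0

lemma continuous_translation (x : L2R) :
    Continuous fun g : HeisenbergWeyl => schrodingerOp ⟨g.τ, 0, 0⟩ x := by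
  let F : HeisenbergWeyl → C(ℝ, ℝ) := fun g => ⟨fun t => t - g.τ, by fun_prop⟩
  have hF : Continuous F := by
    refine ContinuousMap.continuous_of_continuous_uncurry _ ?_
    exact continuous_snd.sub (continuous_τ.comp continuous_fst)
  have hm : ∀ g, MeasurePreserving (F g) volume volume := fun g =>
    measurePreserving_sub_right volume g.τ
  have := (continuous_const (y := x)).compMeasurePreservingLp hF hm (by norm_num)
  refine this.congr fun g => Lp.ext ?_
  filter_upwards [coeFn_schrodingerOp ⟨g.τ, 0, 0⟩ x, Lp.coeFn_compMeasurePreserving x (hm g)]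
    with t h1 h2
  rw [h1, h2]
  simp [schrodingerFun, F]

lemma continuous_schrodingerOp (x : L2R) :
    Continuous fun g : HeisenbergWeyl => schrodingerOp g x := by
  have e : ∀ g : HeisenbergWeyl, schrodingerOp g x =
      schrodingerUnitary ⟨0, g.ν, g.φ⟩ (schrodingerOp ⟨g.τ, 0, 0⟩ x) := by
    intro g
    change _ = schrodingerOp _ _
    rw [← schrodingerOp_mul]
    congr 1
    ext <;> simp
  rw [continuous_iff_continuousAt]
  intro g₀
  have h1 := (continuous_modulation (schrodingerOp ⟨g₀.τ, 0, 0⟩ x)).tendsto g₀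
  have h2 := (continuous_translation x).tendsto g₀
  rw [tendsto_iff_dist_tendsto_zero] at h1 h2
  rw [ContinuousAt, tendsto_iff_dist_tendsto_zero]
  refine squeeze_zero (fun _ => dist_nonneg) (fun g => ?_) (by simpa using h2.add h1)
  rw [e g, e g₀]
  refine (dist_triangle _ (schrodingerUnitary ⟨0, g.ν, g.φ⟩ (schrodingerOp ⟨g₀.τ, 0, 0⟩ x)) _).trans
    (add_le_add ?_ le_rfl)
  rw [LinearIsometryEquiv.dist_map]

/-- The Schrödinger representation `(ρ(τ, ν, φ) x)(t) = e^{iφ} e^{i2πνt} x(t - τ)` on `L²(ℝ)`. -/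
noncomputable def schrodinger : UnitaryRep HeisenbergWeyl L2R where
  toHom :=
    { toFun := schrodingerUnitary
      map_one' := LinearIsometryEquiv.ext schrodingerOp_one
      map_mul' := fun g h => LinearIsometryEquiv.ext (schrodingerOp_mul g h) }
  strongly_continuous := continuous_schrodingerOp

/-- `V_ψ x (τ, ν) = ⟨x, ρ(τ, ν, 0)ψ⟩`, for the inner product of `L²(ℝ)` that is linear in its
first argument (Mathlib's `inner ℂ` is linear in the second). -/
noncomputable def stft (ψ x : L2R) (p : ℝ × ℝ) : ℂ :=
  inner ℂ (schrodinger ⟨p.1, p.2, 0⟩ ψ) x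

end HeisenbergWeyl

namespace HeisenbergWeyl

/-! ### The group, its center and its Haar measures -/

/-! Everything about `schrodinger` itself rests on the Moyal identity. For fixed τ the function
`stft ψ x (τ, ·)` is the Fourier transform of x(t) conj ψ(t - τ), so Plancherel in ν followed by
Tonelli in τ gives ‖x‖²‖ψ‖² (`lintegral_stft_sq`). A vector orthogonal to an orbit then has zero
norm, which is irreducibility. The center contributes only phases, so the coefficients are
square-integrable on H/Z, while over H the φ-line makes the integral infinite. Polarizing in both
arguments (`integral_stft_mul`) gives the orthogonality relations. They force a Duflo-Moore operator
to preserve inner products, and a positive self-adjoint operator with that property is the identity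
(`LinearPMap.eq_id_of_isometric`).

Uniqueness is von Neumann's argument. In any representation with this central character, the
Gaussian average P of the Weyl operators W(z) is symmetric, nonzero and satisfies P W(w) P =
e^{-π|w|²/2} P. A normalized vector in its range therefore has a matrix coefficient independent of
the representation (`exists_gaussian_vector`). Irreducible representations sharing such a
coefficient are equivalent (`IsIrreducible.isEquivalent_of_inner_eq`). -/

lemma mem_center_iff {g : HeisenbergWeyl} :
    g ∈ Subgroup.center HeisenbergWeyl ↔ g.τ = 0 ∧ g.ν = 0 := by
  rw [Subgroup.mem_center_iff]
  constructor
  · intro h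
    -- Commuting with one element in each of the directions τ and ν already forces ν = 0 and τ = 0.
    have h1 := congrArg HeisenbergWeyl.φ (h ⟨1, 0, 0⟩)
    have h2 := congrArg HeisenbergWeyl.φ (h ⟨0, 1, 0⟩)
    simp only [mul_φ, mul_one, mul_zero, zero_mul, sub_zero] at h1 h2
    have hpi := Real.pi_ne_zero
    constructor
    · have h3 : 2 * Real.pi * g.τ = 0 := by linarith
      simpa [hpi] using h3
    · have h3 : 2 * Real.pi * g.ν = 0 := by linarith
      simpa [hpi] using h3
  · rintro ⟨h1, h2⟩ g'
    ext <;> simp [h1, h2, add_comm]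

lemma coe_center : (Subgroup.center HeisenbergWeyl : Set HeisenbergWeyl) =
    {g | g.τ = 0 ∧ g.ν = 0} := by
  ext g
  exact mem_center_iff

/-- Coordinates as a measurable equivalence. -/
def coordsMeasurableEquiv : HeisenbergWeyl ≃ᵐ ℝ × ℝ × ℝ := coordsHomeo.toMeasurableEquiv

lemma haar_eq_map : haar = Measure.map coordsMeasurableEquiv.symm volume := rfl

lemma measurePreserving_coords_symm :
    MeasurePreserving coordsMeasurableEquiv.symm volume haar :=
  ⟨coordsMeasurableEquiv.symm.measurable, rfl⟩

/-- In coordinates, left multiplication translates (τ, ν) and translates φ by an amount depending on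
ν alone: a skew product of translations. For right multiplication the amount depends on τ instead.
-/
lemma measurePreserving_left_shear (g : HeisenbergWeyl) :
    MeasurePreserving (fun p : ℝ × ℝ × ℝ =>
      (g.τ + p.1, g.ν + p.2.1, g.φ - 2 * Real.pi * g.τ * p.2.1 + p.2.2)) volume volume := by
  have h2 : MeasurePreserving (fun p : ℝ × ℝ =>
      (g.ν + p.1, (g.φ - 2 * Real.pi * g.τ * p.1) + p.2)) (volume.prod volume)
        (volume.prod volume) :=
    (measurePreserving_add_left volume g.ν).skew_product
      (g := fun b c : ℝ => (g.φ - 2 * Real.pi * g.τ * b) + c)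
      (by unfold Function.uncurry; fun_prop) (.of_forall fun b => map_add_left_eq_self volume _)
  exact (measurePreserving_add_left volume g.τ).prod h2

lemma measurePreserving_right_shear (g : HeisenbergWeyl) :
    MeasurePreserving (fun p : ℝ × ℝ × ℝ =>
      (g.τ + p.1, g.ν + p.2.1, g.φ - 2 * Real.pi * p.1 * g.ν + p.2.2)) volume volume := by
  have h2 (a : ℝ) : MeasurePreserving (fun p : ℝ × ℝ =>
      (g.ν + p.1, (g.φ - 2 * Real.pi * a * g.ν) + p.2)) (volume.prod volume)
        (volume.prod volume) :=
    (measurePreserving_add_left volume g.ν).prod (measurePreserving_add_left volume _)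
  exact (measurePreserving_add_left volume g.τ).skew_product
      (g := fun (a : ℝ) (p : ℝ × ℝ) => (g.ν + p.1, (g.φ - 2 * Real.pi * a * g.ν) + p.2))
      (by unfold Function.uncurry; fun_prop) (.of_forall fun a => (h2 a).map_eq)

lemma isHaarMeasure_haar : haar.IsHaarMeasure where
  lt_top_of_isCompact K hK := by
    rw [haar_eq_map, MeasurableEquiv.map_apply, ← MeasurableEquiv.image_eq_preimage_symm]
    exact (hK.image coordsHomeo.continuous).measure_lt_top
  map_mul_left_eq_self g := by
    have h := measurePreserving_coords_symm.comp (measurePreserving_left_shear g)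
    have e : (g * ·) ∘ coordsMeasurableEquiv.symm = coordsMeasurableEquiv.symm ∘ fun p =>
      (g.τ + p.1, g.ν + p.2.1, g.φ - 2 * Real.pi * g.τ * p.2.1 + p.2.2) := by
      funext p
      ext
      · rfl
      · rfl
      · change g.φ + p.2.2 - 2 * Real.pi * g.τ * p.2.1 = g.φ - 2 * Real.pi * g.τ * p.2.1 + p.2.2
        ring
    conv_lhs => rw [haar_eq_map]
    rw [Measure.map_map (continuous_const_mul g).measurable
      coordsMeasurableEquiv.symm.measurable, e, h.map_eq]
  open_pos U hU hne := by
    rw [haar_eq_map, MeasurableEquiv.map_apply]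
    exact (hU.preimage coordsHomeo.symm.continuous).measure_ne_zero _
      (hne.preimage coordsHomeo.symm.surjective)

lemma isMulRightInvariant_haar : haar.IsMulRightInvariant where
  map_mul_right_eq_self g := by
    have h := measurePreserving_coords_symm.comp (measurePreserving_right_shear g)
    have e : (· * g) ∘ coordsMeasurableEquiv.symm = coordsMeasurableEquiv.symm ∘ fun p =>
      (g.τ + p.1, g.ν + p.2.1, g.φ - 2 * Real.pi * p.1 * g.ν + p.2.2) := by
      funext p
      ext
      · exact add_comm p.1 g.τ
      · exact add_comm p.2.1 g.ν
      · change p.2.2 + g.φ - 2 * Real.pi * p.1 * g.ν = g.φ - 2 * Real.pi * p.1 * g.ν + p.2.2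
        ring
    conv_lhs => rw [haar_eq_map]
    rw [Measure.map_map (continuous_mul_const g).measurable
      coordsMeasurableEquiv.symm.measurable, e, h.map_eq]

/-- The projection of `H` to `ℝ²`. -/
noncomputable def projHom : HeisenbergWeyl →* Multiplicative (ℝ × ℝ) where
  toFun g := Multiplicative.ofAdd (g.τ, g.ν)
  map_one' := rfl
  map_mul' _ _ := rfl

lemma continuous_projHom : Continuous projHom :=
  continuous_ofAdd.comp (continuous_τ.prodMk continuous_ν)

lemma continuous_section : Continuous fun p : ℝ × ℝ => (⟨p.1, p.2, 0⟩ : HeisenbergWeyl) :=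
  continuous_mk continuous_fst continuous_snd continuous_const

/-- `H ⧸ Z` is isomorphic to `ℝ²` as a topological group. -/
noncomputable def quotientCenterEquiv :
    (HeisenbergWeyl ⧸ Subgroup.center HeisenbergWeyl) ≃ₜ* Multiplicative (ℝ × ℝ) where
  toFun := QuotientGroup.lift (Subgroup.center HeisenbergWeyl) projHom fun g hg => by
    obtain ⟨h1, h2⟩ := mem_center_iff.1 hg
    change Multiplicative.ofAdd (g.τ, g.ν) = 1
    rw [h1, h2]
    rfl
  invFun p := ((⟨p.toAdd.1, p.toAdd.2, 0⟩ : HeisenbergWeyl) :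
    HeisenbergWeyl ⧸ Subgroup.center HeisenbergWeyl)
  left_inv q := by
    induction q using QuotientGroup.induction_on with
    | H g =>
      refine (QuotientGroup.eq).2 (mem_center_iff.2 ⟨?_, ?_⟩)
      · change -g.τ + g.τ = 0
        ring
      · change -g.ν + g.ν = 0
        ring
  right_inv _ := rfl
  map_mul' := map_mul _
  continuous_toFun := continuous_projHom.quotient_lift _
  continuous_invFun := QuotientGroup.continuous_mk.comp (continuous_section.comp continuous_toAdd)

lemma quotientCenterEquiv_coe (g : HeisenbergWeyl) :
    quotientCenterEquiv g = Multiplicative.ofAdd (g.τ, g.ν) := rfl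

/-- The identification of `ℝ²` with `H ⧸ Z` as measurable spaces. -/
noncomputable def planeMeasurableEquiv : ℝ × ℝ ≃ᵐ HeisenbergWeyl ⧸ Subgroup.center HeisenbergWeyl where
  toFun p := ((⟨p.1, p.2, 0⟩ : HeisenbergWeyl) : HeisenbergWeyl ⧸ Subgroup.center HeisenbergWeyl)
  invFun q := (quotientCenterEquiv q).toAdd
  left_inv _ := rfl
  right_inv q := quotientCenterEquiv.symm_apply_apply q
  measurable_toFun := QuotientGroup.measurable_coe.comp continuous_section.measurable
  measurable_invFun := QuotientGroup.measurable_from_quotient.2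
    (continuous_τ.prodMk continuous_ν).measurable

lemma measurePreserving_plane : MeasurePreserving planeMeasurableEquiv volume haarModCenter :=
  ⟨planeMeasurableEquiv.measurable, rfl⟩

lemma measurePreserving_quotientCenterEquiv :
    MeasurePreserving (fun q => (quotientCenterEquiv q).toAdd) haarModCenter volume :=
  measurePreserving_plane.symm

lemma mul_comp_plane (q : HeisenbergWeyl ⧸ Subgroup.center HeisenbergWeyl) :
    (q * ·) ∘ planeMeasurableEquiv =
      planeMeasurableEquiv ∘ fun p => (quotientCenterEquiv q).toAdd + p := by
  funext p
  apply planeMeasurableEquiv.symm.injective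
  change (quotientCenterEquiv (q * planeMeasurableEquiv p)).toAdd = _
  rw [map_mul]
  rfl

lemma haarModCenter_map_mul_left (q : HeisenbergWeyl ⧸ Subgroup.center HeisenbergWeyl) :
    Measure.map (q * ·) haarModCenter = haarModCenter := by
  have hm : Measurable (q * ·) := by
    have h := planeMeasurableEquiv.measurable.comp
      (measurable_const_add (quotientCenterEquiv q).toAdd)
    rw [← mul_comp_plane] at h
    simpa [Function.comp_assoc] using h.comp planeMeasurableEquiv.symm.measurable
  have h := measurePreserving_plane.comp
    (measurePreserving_add_left volume (quotientCenterEquiv q).toAdd)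
  rw [← mul_comp_plane] at h
  rw [← measurePreserving_plane.map_eq, Measure.map_map hm planeMeasurableEquiv.measurable,
    h.map_eq, measurePreserving_plane.map_eq]

lemma isHaarMeasure_haarModCenter : haarModCenter.IsHaarMeasure where
  lt_top_of_isCompact K hK := by
    rw [← measurePreserving_plane.map_eq, MeasurableEquiv.map_apply,
      ← MeasurableEquiv.image_symm]
    exact (hK.image (continuous_toAdd.comp
      quotientCenterEquiv.continuous_toFun)).measure_lt_top
  map_mul_left_eq_self := haarModCenter_map_mul_left
  open_pos U hU hne := by
    rw [← measurePreserving_plane.map_eq, MeasurableEquiv.map_apply]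
    exact (hU.preimage (QuotientGroup.continuous_mk.comp continuous_section)).measure_ne_zero _
      (hne.preimage planeMeasurableEquiv.surjective)

lemma isMulRightInvariant_haarModCenter : haarModCenter.IsMulRightInvariant where
  map_mul_right_eq_self q := by
    -- H/Z is abelian, so left invariance suffices.
    have h : (· * q) = (q * ·) := by
      funext p
      apply quotientCenterEquiv.injective
      rw [map_mul, map_mul, mul_comm]
    rw [h, haarModCenter_map_mul_left]

end HeisenbergWeyl

/-! ### The Plancherel theorem for the Fourier integral -/

open FourierTransform in
lemma continuous_fourier_of_integrable {V : Type*} [NormedAddCommGroup V] [InnerProductSpace ℝ V]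
    [MeasurableSpace V] [BorelSpace V] [FiniteDimensional ℝ V] {f : V → ℂ} (h : Integrable f) :
    Continuous (𝓕 f) :=
  VectorFourier.fourierIntegral_continuous Real.continuous_fourierChar continuous_inner h

open FourierTransform SchwartzMap in
/-- On `L¹ ∩ L²` the Fourier integral is the `L²` Fourier transform. -/
lemma fourier_toLp_ae_eq {f : ℝ → ℂ} (h1 : Integrable f) (h2 : MemLp f 2) :
    (𝓕 (h2.toLp f) : Lp ℂ 2 (volume : Measure ℝ)) =ᵐ[volume] 𝓕 f := by
  -- Both sides are locally integrable, so testing against smooth compactly supported functions is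
  -- enough. On the left the transform moves to the test function by the distributional definition,
  -- on the right by Fubini for the Fourier integral.
  refine ae_eq_of_integral_contDiff_smul_eq
    ((Lp.memLp _).locallyIntegrable (by norm_num))
    (continuous_fourier_of_integrable h1).locallyIntegrable fun g hg hgc => ?_
  have hg' := Complex.ofRealCLM.contDiff.comp hg
  have hgc' : HasCompactSupport (Complex.ofRealCLM ∘ g) := hgc.comp_left Complex.ofReal_zero
  let G : 𝓢(ℝ, ℂ) := hgc'.toSchwartzMap hg'
  have hG : ∀ (x : ℝ) (z : ℂ), G x • z = g x • z := fun x z => Complex.coe_smul (g x) z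
  have e1 := congrArg (fun T : 𝓢'(ℝ, ℂ) => T G)
    (Lp.fourier_toTemperedDistribution_eq (h2.toLp f))
  simp only [TemperedDistribution.fourier_apply, Lp.toTemperedDistribution_apply] at e1
  have e2 : ∫ ξ, 𝓕 G ξ • f ξ = ∫ x, G x • 𝓕 f x := by
    have := VectorFourier.integral_fourierIntegral_smul_eq_flip (L := innerₗ ℝ)
      Real.continuous_fourierChar continuous_inner (G.integrable (μ := volume)) h1
    rw [flip_innerₗ] at this
    rw [SchwartzMap.fourier_coe]
    exact this
  simp only [← hG]
  rw [← e1, ← e2]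
  refine integral_congr_ae ?_
  filter_upwards [h2.coeFn_toLp] with x hx
  rw [hx]

open FourierTransform in
lemma lintegral_fourier_sq {f : ℝ → ℂ} (h1 : Integrable f) (h2 : MemLp f 2) :
    ∫⁻ ξ, ‖𝓕 f ξ‖ₑ ^ 2 = ∫⁻ t, ‖f t‖ₑ ^ 2 := by
  have e : eLpNorm (𝓕 f) 2 volume = eLpNorm f 2 volume := by
    rw [← eLpNorm_congr_ae (fourier_toLp_ae_eq h1 h2), ← eLpNorm_congr_ae h2.coeFn_toLp,
      ← Lp.enorm_def, ← Lp.enorm_def, enorm_eq_iff_norm_eq, Lp.norm_fourier_eq]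
  simp only [eLpNorm_eq_lintegral_rpow_enorm_toReal (p := 2) (by norm_num) (by norm_num),
    ENNReal.toReal_ofNat, ENNReal.rpow_ofNat] at e
  exact ENNReal.rpow_left_injective (by norm_num) e

/-- A map that is conjugate linear in the first and linear in the second argument, and vanishes
on the diagonal, is zero. -/
lemma sesquilinear_eq_zero {E : Type*} [AddCommGroup E] [Module ℂ E] (D : E → E → ℂ)
    (add_left : ∀ u u' v, D (u + u') v = D u v + D u' v)
    (add_right : ∀ u v v', D u (v + v') = D u v + D u v')
    (smul_left : ∀ (c : ℂ) u v, D (c • u) v = starRingEnd ℂ c * D u v)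
    (smul_right : ∀ (c : ℂ) u v, D u (c • v) = c * D u v)
    (diag : ∀ v, D v v = 0) (u v : E) : D u v = 0 := by
  have h1 := diag (u + v)
  have h2 := diag (u + Complex.I • v)
  simp only [add_left, add_right, smul_left, smul_right, diag, Complex.conj_I] at h1 h2
  -- The cross terms give D(u,v) + D(v,u) = 0 and iD(u,v) - iD(v,u) = 0.
  have h3 : Complex.I * (2 * D u v) = 0 := by linear_combination h2 + Complex.I * h1
  simpa using h3

namespace HeisenbergWeyl

/-! ### The Moyal identity -/

lemma schrodinger_apply (g : HeisenbergWeyl) (x : L2R) : schrodinger g x = schrodingerOp g x := rfl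

lemma lintegral_enorm_sq (x : L2R) : ∫⁻ t, ‖x t‖ₑ ^ 2 = ‖x‖ₑ ^ 2 := by
  rw [Lp.enorm_def, eLpNorm_eq_lintegral_rpow_enorm_toReal (by norm_num) (by norm_num),
    ← ENNReal.rpow_natCast, ← ENNReal.rpow_mul]
  norm_num

open FourierTransform in
-- The inner product conjugates the modulation e^{2πiνt}, turning it into the Fourier kernel at
-- frequency ν.
lemma stft_eq_fourier (ψ x : L2R) (p : ℝ × ℝ) :
    stft ψ x p = 𝓕 (fun t : ℝ => x t * starRingEnd ℂ (ψ (t - p.1))) p.2 := by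
  rw [stft, schrodinger_apply, L2.inner_def, Real.fourier_real_eq_integral_exp_smul]
  refine integral_congr_ae ?_
  filter_upwards [coeFn_schrodingerOp ⟨p.1, p.2, 0⟩ ψ] with t ht
  rw [ht]
  simp only [schrodingerFun, RCLike.inner_apply, map_mul, ← Complex.exp_conj, Complex.conj_I,
    Complex.conj_ofReal, smul_eq_mul]
  simp only [Complex.ofReal_zero, mul_zero, Complex.exp_zero, one_mul, Complex.conj_ofNat]
  have : -Complex.I * (2 * Real.pi * p.2 * t) = ((-2 * Real.pi * t * p.2 : ℝ) : ℂ) * Complex.I := by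
    push_cast
    ring
  rw [this]
  ring

lemma continuous_stft (ψ x : L2R) : Continuous (stft ψ x) :=
  ((schrodinger.strongly_continuous ψ).comp continuous_section).inner continuous_const

lemma measurable_window (ψ x : L2R) :
    Measurable fun p : ℝ × ℝ => x p.2 * starRingEnd ℂ (ψ (p.2 - p.1)) :=
  ((Lp.stronglyMeasurable x).measurable.comp measurable_snd).mul
    (RCLike.continuous_conj.measurable.comp
      ((Lp.stronglyMeasurable ψ).measurable.comp (measurable_snd.sub measurable_fst)))

/-- By Tonelli the shift can be integrated first. Invariance of Lebesgue measure under s ↦ t - s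
then yields ‖ψ‖² for every t. -/
lemma lintegral_window (ψ x : L2R) :
    ∫⁻ s : ℝ, ∫⁻ t : ℝ, ‖x t * starRingEnd ℂ (ψ (t - s))‖ₑ ^ 2 = ‖x‖ₑ ^ 2 * ‖ψ‖ₑ ^ 2 := by
  rw [lintegral_lintegral_swap ((measurable_window ψ x).enorm.pow_const 2).aemeasurable]
  have e (t : ℝ) : ∫⁻ s : ℝ, ‖x t * starRingEnd ℂ (ψ (t - s))‖ₑ ^ 2 =
      ‖x t‖ₑ ^ 2 * ‖ψ‖ₑ ^ 2 := by
    simp only [enorm_mul, mul_pow, RCLike.enorm_conj]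
    rw [lintegral_const_mul' _ _ (by finiteness),
      lintegral_sub_left_eq_self (fun s => ‖ψ s‖ₑ ^ 2) t, lintegral_enorm_sq]
  simp only [e]
  rw [lintegral_mul_const' _ _ (by finiteness), lintegral_enorm_sq]

lemma integrable_window (ψ x : L2R) (s : ℝ) :
    Integrable fun t : ℝ => x t * starRingEnd ℂ (ψ (t - s)) :=
  (Lp.memLp x).integrable_mul
    ((Lp.memLp ψ).comp_measurePreserving (measurePreserving_sub_right volume s)).star

lemma lintegral_stft_sq (ψ x : L2R) :
    ∫⁻ p, ‖stft ψ x p‖ₑ ^ 2 = ‖x‖ₑ ^ 2 * ‖ψ‖ₑ ^ 2 := by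
  rw [Measure.volume_eq_prod, lintegral_prod _
    ((continuous_stft ψ x).measurable.enorm.pow_const 2).aemeasurable, ← lintegral_window ψ x]
  refine lintegral_congr_ae ?_
  -- A product of two L² functions is L¹ for every shift, but L² only for almost every shift. That
  -- is enough to apply Plancherel under the outer integral.
  have hfin : ∀ᵐ s : ℝ, ∫⁻ t : ℝ, ‖x t * starRingEnd ℂ (ψ (t - s))‖ₑ ^ 2 < ∞ := by
    refine ae_lt_top ((measurable_window ψ x).enorm.pow_const 2).lintegral_prod_right' ?_
    rw [lintegral_window]
    finiteness
  filter_upwards [hfin] with s hs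
  simp only [stft_eq_fourier]
  refine lintegral_fourier_sq (integrable_window ψ x s)
    ⟨(integrable_window ψ x s).aestronglyMeasurable, ?_⟩
  rw [eLpNorm_lt_top_iff_lintegral_rpow_enorm_lt_top (by norm_num) (by norm_num)]
  simpa using hs

lemma memLp_stft (ψ x : L2R) : MemLp (stft ψ x) 2 := by
  refine ⟨(continuous_stft ψ x).aestronglyMeasurable, ?_⟩
  rw [eLpNorm_lt_top_iff_lintegral_rpow_enorm_lt_top (by norm_num) (by norm_num)]
  simp only [ENNReal.toReal_ofNat, ENNReal.rpow_ofNat, lintegral_stft_sq]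
  finiteness

lemma integrable_stft_sq (ψ x : L2R) : Integrable fun p => ‖stft ψ x p‖ ^ 2 :=
  (memLp_stft ψ x).integrable_norm_pow (by norm_num)

lemma integral_stft_sq (ψ x : L2R) : ∫ p, ‖stft ψ x p‖ ^ 2 = ‖x‖ ^ 2 * ‖ψ‖ ^ 2 := by
  rw [integral_eq_lintegral_of_nonneg_ae (.of_forall fun p => by positivity)
    (integrable_stft_sq ψ x).aestronglyMeasurable]
  have e (p : ℝ × ℝ) : ENNReal.ofReal (‖stft ψ x p‖ ^ 2) = ‖stft ψ x p‖ₑ ^ 2 := by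
    rw [ENNReal.ofReal_pow (norm_nonneg _), ofReal_norm]
  simp only [e, lintegral_stft_sq, ENNReal.toReal_mul, ENNReal.toReal_pow, toReal_enorm]

lemma stft_add_left (ψ ψ' x : L2R) (p : ℝ × ℝ) :
    stft (ψ + ψ') x p = stft ψ x p + stft ψ' x p := by
  rw [stft, map_add, inner_add_left]
  rfl

lemma stft_smul_left (c : ℂ) (ψ x : L2R) (p : ℝ × ℝ) :
    stft (c • ψ) x p = starRingEnd ℂ c * stft ψ x p := by
  rw [stft, map_smul, inner_smul_left]
  rfl

lemma stft_add_right (ψ x x' : L2R) (p : ℝ × ℝ) :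
    stft ψ (x + x') p = stft ψ x p + stft ψ x' p := inner_add_right _ _ _

lemma stft_smul_right (c : ℂ) (ψ x : L2R) (p : ℝ × ℝ) :
    stft ψ (c • x) p = c * stft ψ x p := inner_smul_right _ _ _

lemma integrable_stft_mul (ψ₁ ψ₂ x₁ x₂ : L2R) :
    Integrable fun p => starRingEnd ℂ (stft ψ₁ x₁ p) * stft ψ₂ x₂ p :=
  (memLp_stft ψ₁ x₁).star.integrable_mul (memLp_stft ψ₂ x₂)

/-- Both sides are sesquilinear in (x₁, x₂) and agree on the diagonal by the Moyal identity. -/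
lemma integral_stft_mul_same (ψ x₁ x₂ : L2R) :
    ∫ p, starRingEnd ℂ (stft ψ x₁ p) * stft ψ x₂ p = ‖ψ‖ ^ 2 * inner ℂ x₁ x₂ := by
  rw [← sub_eq_zero]
  refine sesquilinear_eq_zero (fun x₁ x₂ => (∫ p, starRingEnd ℂ (stft ψ x₁ p) * stft ψ x₂ p) -
    ‖ψ‖ ^ 2 * inner ℂ x₁ x₂) ?_ ?_ ?_ ?_ ?_ x₁ x₂
  · intro u u' v
    simp only [stft_add_right, map_add, add_mul, inner_add_left]
    rw [integral_add (integrable_stft_mul _ _ _ _) (integrable_stft_mul _ _ _ _)]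
    ring
  · intro u v v'
    simp only [stft_add_right, mul_add, inner_add_right]
    rw [integral_add (integrable_stft_mul _ _ _ _) (integrable_stft_mul _ _ _ _)]
    ring
  · intro c u v
    simp only [stft_smul_right, map_mul, mul_assoc, inner_smul_left]
    rw [integral_const_mul]
    ring
  · intro c u v
    simp only [stft_smul_right, mul_left_comm _ c, inner_smul_right]
    rw [integral_const_mul]
    ring
  · intro v
    have e (p : ℝ × ℝ) : starRingEnd ℂ (stft ψ v p) * stft ψ v p =
        ((‖stft ψ v p‖ ^ 2 : ℝ) : ℂ) := by
      rw [Complex.conj_mul']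
      push_cast
      rfl
    simp only [e]
    rw [integral_complex_ofReal, integral_stft_sq, inner_self_eq_norm_sq_to_K]
    push_cast
    simp only [RCLike.ofReal_eq_complex_ofReal]
    ring

/-- The polarized Moyal identity. -/
lemma integral_stft_mul (ψ₁ ψ₂ x₁ x₂ : L2R) :
    ∫ p, starRingEnd ℂ (stft ψ₁ x₁ p) * stft ψ₂ x₂ p = inner ℂ ψ₂ ψ₁ * inner ℂ x₁ x₂ := by
  rw [← sub_eq_zero]
  -- The windows enter in reversed order: `stft` is conjugate linear in its window, so the integral
  -- is conjugate linear in ψ₂ and linear in ψ₁.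
  refine sesquilinear_eq_zero (fun ψ₂ ψ₁ => (∫ p, starRingEnd ℂ (stft ψ₁ x₁ p) * stft ψ₂ x₂ p) -
    inner ℂ ψ₂ ψ₁ * inner ℂ x₁ x₂) ?_ ?_ ?_ ?_ ?_ ψ₂ ψ₁
  · intro u u' v
    simp only [stft_add_left, mul_add, inner_add_left]
    rw [integral_add (integrable_stft_mul _ _ _ _) (integrable_stft_mul _ _ _ _)]
    ring
  · intro u v v'
    simp only [stft_add_left, map_add, add_mul, inner_add_right]
    rw [integral_add (integrable_stft_mul _ _ _ _) (integrable_stft_mul _ _ _ _)]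
    ring
  · intro c u v
    simp only [stft_smul_left, mul_left_comm _ (starRingEnd ℂ c), inner_smul_left]
    rw [integral_const_mul]
    ring
  · intro c u v
    simp only [stft_smul_left, map_mul, Complex.conj_conj, mul_assoc, inner_smul_right]
    rw [integral_const_mul]
    ring
  · intro v
    rw [integral_stft_mul_same, inner_self_eq_norm_sq_to_K]
    exact sub_self _

end HeisenbergWeyl

namespace HeisenbergWeyl

/-! ### Irreducibility and square-integrability of the Schrödinger representation -/

lemma central_apply {K : Type*} [NormedAddCommGroup K] [InnerProductSpace ℂ K]
    {π : UnitaryRep HeisenbergWeyl K} (hπ : HasCentralCharacter π) (g : HeisenbergWeyl) (v : K) :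
    π g v = Complex.exp (Complex.I * g.φ) • π ⟨g.τ, g.ν, 0⟩ v := by
  have e : g = ⟨0, 0, g.φ⟩ * ⟨g.τ, g.ν, 0⟩ := by ext <;> simp
  conv_lhs => rw [e, map_mul]
  exact hπ _ _

lemma hasCentralCharacter_schrodinger : HasCentralCharacter schrodinger := by
  intro φ v
  refine Lp.ext ?_
  filter_upwards [coeFn_schrodingerOp ⟨0, 0, φ⟩ v,
    Lp.coeFn_smul (Complex.exp (Complex.I * φ)) v] with t h1 h2
  rw [schrodinger_apply, h1, h2]
  simp [schrodingerFun]

lemma inner_schrodinger (g : HeisenbergWeyl) (ψ x : L2R) :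
    inner ℂ (schrodinger g ψ) x =
      starRingEnd ℂ (Complex.exp (Complex.I * g.φ)) * stft ψ x (g.τ, g.ν) := by
  rw [central_apply hasCentralCharacter_schrodinger, inner_smul_left]
  rfl

lemma norm_exp_I_mul (a : ℝ) : ‖Complex.exp (Complex.I * a)‖ = 1 := by
  rw [mul_comm, Complex.norm_exp_ofReal_mul_I]

lemma enorm_inner_schrodinger (g : HeisenbergWeyl) (ψ x : L2R) :
    ‖inner ℂ (schrodinger g ψ) x‖ₑ = ‖stft ψ x (g.τ, g.ν)‖ₑ := by
  rw [enorm_eq_iff_norm_eq, inner_schrodinger, norm_mul, RCLike.norm_conj, norm_exp_I_mul, one_mul]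

lemma nontrivial_L2R : Nontrivial L2R := by
  have hs : volume (Set.Icc (0 : ℝ) 1) ≠ ∞ := by simp
  refine ⟨⟨indicatorConstLp 2 measurableSet_Icc hs 1, 0, fun h => ?_⟩⟩
  have h' := congrArg norm h
  rw [norm_indicatorConstLp (by norm_num) (by norm_num)] at h'
  norm_num [Measure.real] at h'

/-- If x is orthogonal to an invariant subspace containing ψ ≠ 0, then `stft ψ x` vanishes
identically, and Moyal gives ‖x‖‖ψ‖ = 0. -/
lemma isIrreducible_schrodinger : schrodinger.IsIrreducible := by
  refine ⟨nontrivial_L2R, fun W hW hinv => or_iff_not_imp_left.2 fun hne => ?_⟩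
  obtain ⟨ψ, hψ, hψ0⟩ := Submodule.exists_mem_ne_zero_of_ne_bot hne
  have : CompleteSpace W := hW.completeSpace_coe
  rw [← Submodule.orthogonal_eq_bot_iff, Submodule.eq_bot_iff]
  intro x hx
  have h0 (p : ℝ × ℝ) : stft ψ x p = 0 :=
    (Submodule.mem_orthogonal W x).1 hx _ (hinv ⟨p.1, p.2, 0⟩ ψ hψ)
  have h := lintegral_stft_sq ψ x
  simp only [h0] at h
  simpa [hψ0] using h

/-- The integrand does not depend on φ, so its integral is ‖ψ‖⁴ times the infinite length of the
φ-line. -/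
lemma not_isSquareIntegrable_schrodinger : ¬ schrodinger.IsSquareIntegrable haar := by
  rintro ⟨ψ, hψ, hfin⟩
  have e : ∫⁻ g, ‖inner ℂ (schrodinger g ψ) ψ‖ₑ ^ 2 ∂haar = ∞ := by
    rw [← measurePreserving_coords_symm.lintegral_comp_emb
      coordsMeasurableEquiv.symm.measurableEmbedding]
    simp only [enorm_inner_schrodinger]
    change ∫⁻ p : ℝ × ℝ × ℝ, ‖stft ψ ψ (p.1, p.2.1)‖ₑ ^ 2 = ∞
    have hm : Measurable fun p : ℝ × ℝ => ‖stft ψ ψ p‖ₑ ^ 2 :=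
      (continuous_stft ψ ψ).measurable.enorm.pow_const 2
    rw [← MeasurePreserving.lintegral_comp_emb (volume_preserving_prodAssoc (α₁ := ℝ) (β₁ := ℝ)
      (γ₁ := ℝ)) MeasurableEquiv.prodAssoc.measurableEmbedding]
    change ∫⁻ p : (ℝ × ℝ) × ℝ, ‖stft ψ ψ p.1‖ₑ ^ 2 = ∞
    rw [Measure.volume_eq_prod, lintegral_prod (fun p : (ℝ × ℝ) × ℝ => ‖stft ψ ψ p.1‖ₑ ^ 2)
      (hm.comp measurable_fst).aemeasurable]
    simp only [lintegral_const, Real.volume_univ]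
    rw [lintegral_mul_const _ hm, lintegral_stft_sq]
    exact ENNReal.mul_top (by simpa using hψ)
  exact hfin.ne e

lemma isAdmissibleModCenter_schrodinger {ψ : L2R} (hψ : ψ ≠ 0) :
    schrodinger.IsAdmissibleModCenter haarModCenter ψ := by
  refine ⟨hψ, fun q => ‖stft ψ ψ (quotientCenterEquiv q).toAdd‖ₑ ^ 2,
    fun g => by rw [enorm_inner_schrodinger]; rfl, ?_⟩
  rw [measurePreserving_quotientCenterEquiv.lintegral_comp
    ((continuous_stft ψ ψ).measurable.enorm.pow_const 2), lintegral_stft_sq]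
  finiteness

lemma isSquareIntegrableModCenter_schrodinger :
    schrodinger.IsSquareIntegrableModCenter haarModCenter := by
  have := nontrivial_L2R
  obtain ⟨ψ, hψ⟩ := exists_ne (0 : L2R)
  exact ⟨ψ, isAdmissibleModCenter_schrodinger hψ⟩

/-- The orthogonality relations of the Schrödinger representation on `H ⧸ Z`. -/
lemma schrodinger_orthogonality (ψ₁ ψ₂ φ₁ φ₂ : L2R) :
    ∃ f : HeisenbergWeyl ⧸ Subgroup.center HeisenbergWeyl → ℂ,
      (∀ g : HeisenbergWeyl, f g = inner ℂ φ₁ (schrodinger g ψ₁) *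
        starRingEnd ℂ (inner ℂ φ₂ (schrodinger g ψ₂))) ∧
      Integrable f haarModCenter ∧
      ∫ q, f q ∂haarModCenter = inner ℂ ψ₂ ψ₁ * inner ℂ φ₁ φ₂ := by
  refine ⟨fun q => starRingEnd ℂ (stft ψ₁ φ₁ (quotientCenterEquiv q).toAdd) *
    stft ψ₂ φ₂ (quotientCenterEquiv q).toAdd, fun g => ?_, ?_, ?_⟩
  · rw [← inner_conj_symm φ₁, inner_conj_symm _ φ₂, inner_schrodinger, inner_schrodinger]
    beta_reduce
    rw [quotientCenterEquiv_coe]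
    -- The central phases of the two coefficients cancel, so the product descends to H/Z.
    have h : Complex.exp (Complex.I * g.φ) * starRingEnd ℂ (Complex.exp (Complex.I * g.φ)) = 1 := by
      rw [Complex.mul_conj', norm_exp_I_mul]
      simp
    simp only [map_mul, Complex.conj_conj, toAdd_ofAdd]
    linear_combination -(starRingEnd ℂ (stft ψ₁ φ₁ (g.τ, g.ν)) * stft ψ₂ φ₂ (g.τ, g.ν)) * h
  · exact measurePreserving_quotientCenterEquiv.integrable_comp_of_integrable
      (integrable_stft_mul ψ₁ ψ₂ φ₁ φ₂)
  · rw [← integral_stft_mul]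
    exact measurePreserving_plane.symm.integral_comp planeMeasurableEquiv.symm.measurableEmbedding
      (fun p => starRingEnd ℂ (stft ψ₁ φ₁ p) * stft ψ₂ φ₂ p)

end HeisenbergWeyl

/-! ### Isometric positive self-adjoint operators -/

lemma LinearPMap.isSelfAdjoint_id_toPMap {E : Type*} [NormedAddCommGroup E] [InnerProductSpace ℂ E]
    [CompleteSpace E] : IsSelfAdjoint ((LinearMap.id : E →ₗ[ℂ] E).toPMap ⊤) := by
  have h := ContinuousLinearMap.toPMap_adjoint_eq_adjoint_toPMap_of_dense
    (A := ContinuousLinearMap.id ℂ E) (p := ⊤) dense_univ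
  rw [LinearPMap.isSelfAdjoint_def]
  rw [← ContinuousLinearMap.star_eq_adjoint] at h
  have e : star (ContinuousLinearMap.id ℂ E) = ContinuousLinearMap.id ℂ E :=
    star_one (E →L[ℂ] E)
  rw [e] at h
  exact h

/-- A positive self-adjoint operator that preserves inner products on its domain is the
identity. -/
lemma LinearPMap.eq_id_of_isometric {E : Type*} [NormedAddCommGroup E] [InnerProductSpace ℂ E]
    [CompleteSpace E] {C : E →ₗ.[ℂ] E} (hC : IsSelfAdjoint C)
    (hpos : ∀ v : C.domain, 0 ≤ (inner ℂ (v : E) (C v)).re)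
    (hiso : ∀ v w : C.domain, inner ℂ (C v) (C w) = inner ℂ (v : E) (w : E)) :
    C = (LinearMap.id : E →ₗ[ℂ] E).toPMap ⊤ := by
  have hdense := hC.dense_domain
  have hnorm (v : C.domain) : ‖C v‖ = ‖(v : E)‖ := by
    rw [← sq_eq_sq₀ (norm_nonneg _) (norm_nonneg _), ← inner_self_eq_norm_sq (𝕜 := ℂ),
      ← inner_self_eq_norm_sq (𝕜 := ℂ), hiso]
  have hisom : Isometry C.toFun := AddMonoidHomClass.isometry_of_norm C.toFun hnorm
  -- C is isometric with closed graph: convergent points of the domain have Cauchy images, so the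
  -- limit pair lies in the graph.
  have hcl : _root_.IsClosed (C.domain : Set E) := by
    refine isClosed_of_closure_subset fun x hx => ?_
    obtain ⟨u, hu, hux⟩ := mem_closure_iff_seq_limit.1 hx
    have hcu : CauchySeq fun n => (⟨u n, hu n⟩ : C.domain) :=
      isometry_subtype_coe.isUniformInducing.cauchy_map_iff.1 hux.cauchySeq
    obtain ⟨y, hy⟩ := cauchySeq_tendsto_of_complete (hisom.uniformContinuous.comp_cauchySeq hcu)
    have hg : (x, y) ∈ (C.graph : Set (E × E)) :=
      hC.isClosed.mem_of_tendsto (hux.prodMk_nhds hy)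
        (.of_forall fun n => C.mem_graph ⟨u n, hu n⟩)
    obtain ⟨z, hz, -⟩ := C.mem_graph_iff.1 hg
    have hz' : (z : E) = x := hz
    exact hz' ▸ z.2
  have htop : C.domain = ⊤ := by
    rw [← hcl.submodule_topologicalClosure_eq]
    exact Submodule.dense_iff_topologicalClosure_eq_top.1 hdense
  have hmem (v : E) : v ∈ C.domain := htop ▸ Submodule.mem_top
  have hsymm := C.adjoint_isFormalAdjoint hdense
  rw [LinearPMap.isSelfAdjoint_def.1 hC] at hsymm
  -- Symmetry together with isometry gives C² = 1.
  have hsq (v : C.domain) : C ⟨C v, hmem _⟩ = v := by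
    refine ext_inner_right ℂ fun y => ?_
    exact (hsymm ⟨C v, hmem _⟩ ⟨y, hmem y⟩).trans (hiso v ⟨y, hmem y⟩)
  have hid (v : C.domain) : C v = v := by
    -- Since C² = 1, the vector Cv - v lies in the (-1)-eigenspace, which positivity makes trivial.
    have hw : C (⟨C v, hmem _⟩ - v) = -(((⟨C v, hmem _⟩ - v : C.domain)) : E) := by
      rw [LinearPMap.map_sub, hsq]
      simp
    have h := hpos (⟨C v, hmem _⟩ - v)
    rw [hw, inner_neg_right, Complex.neg_re, ← RCLike.re_eq_complex_re,
      inner_self_eq_norm_sq] at h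
    have h' : ‖((⟨C v, hmem _⟩ - v : C.domain) : E)‖ ^ 2 = 0 :=
      le_antisymm (by linarith) (sq_nonneg _)
    simpa [sub_eq_zero] using h'
  exact LinearPMap.ext htop fun x hx _ => hid ⟨x, hx⟩

namespace HeisenbergWeyl

/-- The identity is the unique Duflo-Moore operator of the Schrödinger representation. -/
lemma isDufloMooreModCenter_schrodinger_iff (C : L2R →ₗ.[ℂ] L2R) :
    schrodinger.IsDufloMooreModCenter haarModCenter C ↔
      C = (LinearMap.id : L2R →ₗ[ℂ] L2R).toPMap ⊤ := by
  constructor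
  · rintro ⟨-, hsa, hpos, horth⟩
    refine LinearPMap.eq_id_of_isometric hsa hpos fun v w => ?_
    have := nontrivial_L2R
    obtain ⟨φ, hφ⟩ := exists_ne (0 : L2R)
    -- One nonzero φ in both slots suffices: ⟨φ, φ⟩ cancels. The descended functions agree because
    -- each is determined by its values on representatives.
    obtain ⟨f, hf, -, hfint⟩ := horth w v φ φ
    obtain ⟨f', hf', -, hfint'⟩ := schrodinger_orthogonality w v φ φ
    have e : f = f' := by
      funext q
      induction q using QuotientGroup.induction_on with
      | H g => rw [hf, hf']
    rw [e, hfint'] at hfint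
    exact (mul_right_cancel₀ (inner_self_ne_zero.2 hφ) hfint).symm
  · rintro rfl
    exact ⟨dense_univ, LinearPMap.isSelfAdjoint_id_toPMap,
      fun v => inner_self_nonneg (𝕜 := ℂ) (x := (v : L2R)),
      fun ψ₁ ψ₂ φ₁ φ₂ => schrodinger_orthogonality ψ₁ ψ₂ φ₁ φ₂⟩

end HeisenbergWeyl

/-! ### Irreducible representations with a common matrix coefficient -/

namespace UnitaryRep

variable {G : Type*} [Group G] [TopologicalSpace G]
variable {K : Type*} [NormedAddCommGroup K] [InnerProductSpace ℂ K]
variable {K' : Type*} [NormedAddCommGroup K'] [InnerProductSpace ℂ K']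

lemma map_mul_apply (ρ : UnitaryRep G K) (g h : G) (v : K) : ρ (g * h) v = ρ g (ρ h v) := by
  rw [map_mul]
  rfl

lemma map_one_apply (ρ : UnitaryRep G K) (v : K) : ρ 1 v = v := by
  rw [map_one]
  rfl

lemma inner_map_left (ρ : UnitaryRep G K) (g : G) (u v : K) :
    inner ℂ (ρ g u) v = inner ℂ u (ρ g⁻¹ v) := by
  rw [← LinearIsometryEquiv.inner_map_map (ρ g) u, ← map_mul_apply, mul_inv_cancel, map_one_apply]

/-- The linear combinations of the orbit of a vector. -/
noncomputable def orbitMap (ρ : UnitaryRep G K) (Ω : K) : (G →₀ ℂ) →ₗ[ℂ] K :=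
  Finsupp.linearCombination ℂ fun g => ρ g Ω

lemma orbitMap_mapDomain (ρ : UnitaryRep G K) (Ω : K) (g : G) (a : G →₀ ℂ) :
    ρ.orbitMap Ω (a.mapDomain (g * ·)) = ρ g (ρ.orbitMap Ω a) := by
  rw [orbitMap, Finsupp.linearCombination_mapDomain, Finsupp.linearCombination_apply,
    Finsupp.linearCombination_apply, map_finsuppSum]
  simp

/-- The Gram matrix of the orbit depends only on the function g ↦ ⟨Ω, ρ(g)Ω⟩. -/
lemma inner_orbitMap (ρ : UnitaryRep G K) (Ω : K) (a b : G →₀ ℂ) :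
    inner ℂ (ρ.orbitMap Ω a) (ρ.orbitMap Ω b) =
      a.sum fun g c => b.sum fun h d => d * (starRingEnd ℂ c * inner ℂ Ω (ρ (g⁻¹ * h) Ω)) := by
  rw [orbitMap, Finsupp.linearCombination_apply, Finsupp.linearCombination_apply,
    Finsupp.sum_inner]
  simp only [Finsupp.inner_sum, inner_smul_left, inner_smul_right, inner_map_left, map_mul_apply]

/-- The closed span of the orbit is invariant and contains Ω, so it cannot be zero. -/
lemma IsIrreducible.denseRange_orbitMap {ρ : UnitaryRep G K} (hρ : ρ.IsIrreducible) {Ω : K}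
    (hΩ : Ω ≠ 0) : DenseRange (ρ.orbitMap Ω) := by
  have h := hρ.2 (LinearMap.range (ρ.orbitMap Ω)).topologicalClosure
    (Submodule.isClosed_topologicalClosure _) fun g v hv => by
      refine map_mem_closure (ρ g).continuous hv ?_
      rintro _ ⟨a, rfl⟩
      exact ⟨a.mapDomain (g * ·), ρ.orbitMap_mapDomain Ω g a⟩
  rcases h with h | h
  · have hmem : Ω ∈ (LinearMap.range (ρ.orbitMap Ω)).topologicalClosure :=
      Submodule.le_topologicalClosure _
        ⟨Finsupp.single 1 1, by simp [orbitMap]⟩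
    rw [h] at hmem
    exact (hΩ hmem).elim
  · exact Submodule.dense_iff_topologicalClosure_eq_top.2 h

/-- Irreducible representations that share a nonzero matrix coefficient of positive type are
equivalent. -/
lemma IsIrreducible.isEquivalent_of_inner_eq [CompleteSpace K] [CompleteSpace K']
    {ρ : UnitaryRep G K} {ρ' : UnitaryRep G K'} (hρ : ρ.IsIrreducible) (hρ' : ρ'.IsIrreducible)
    {Ω : K} {Ω' : K'} (hΩ : Ω ≠ 0) (hΩ' : Ω' ≠ 0)
    (h : ∀ g, inner ℂ Ω (ρ g Ω) = inner ℂ Ω' (ρ' g Ω')) : ρ.IsEquivalent ρ' := by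
  have hd := hρ.denseRange_orbitMap hΩ
  have hnorm (a : G →₀ ℂ) : ‖ρ'.orbitMap Ω' (LinearEquiv.refl ℂ _ a)‖ = ‖ρ.orbitMap Ω a‖ := by
    rw [← sq_eq_sq₀ (norm_nonneg _) (norm_nonneg _), ← inner_self_eq_norm_sq (𝕜 := ℂ),
      ← inner_self_eq_norm_sq (𝕜 := ℂ), LinearEquiv.refl_apply, inner_orbitMap, inner_orbitMap]
    simp only [h]
  -- Combinations with the same coefficients correspond. Equal Gram matrices make this well defined
  -- and isometric, and density extends it.
  let U : K ≃ₗᵢ[ℂ] K' := (LinearEquiv.refl ℂ (G →₀ ℂ)).extendOfIsometry (ρ.orbitMap Ω)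
    (ρ'.orbitMap Ω') hd (hρ'.denseRange_orbitMap hΩ') hnorm
  have hU (a : G →₀ ℂ) : U (ρ.orbitMap Ω a) = ρ'.orbitMap Ω' a :=
    LinearEquiv.extendOfIsometry_eq _ _ _ _ _ _ a
  refine ⟨U, fun g v => congrFun (hd.equalizer (U.continuous.comp (ρ g).continuous)
    ((ρ' g).continuous.comp U.continuous) ?_) v⟩
  funext a
  simp only [Function.comp_apply]
  rw [← orbitMap_mapDomain, hU, hU, orbitMap_mapDomain]

end UnitaryRep

lemma LinearIsometryEquiv.integral_comp_comm {X K : Type*} [MeasurableSpace X] {μ : Measure X}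
    [NormedAddCommGroup K] [InnerProductSpace ℂ K] [CompleteSpace K] (U : K ≃ₗᵢ[ℂ] K) (f : X → K) :
    ∫ x, U (f x) ∂μ = U (∫ x, f x ∂μ) :=
  U.toLinearIsometry.integral_comp_comm f

namespace HeisenbergWeyl

/-! ### The Gaussian vectors of a representation with central character `e^{iφ}` -/

/-- The point of `H` over `z = τ + iν` for which `z ↦ -z` corresponds to inversion. -/
noncomputable def weylPoint (z : ℂ) : HeisenbergWeyl := ⟨z.re, z.im, -(Real.pi * z.re * z.im)⟩

/-- The third coordinate -πτν makes the cocycle antisymmetric, namely the symplectic form on ℂ. -/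
lemma weylPoint_mul (z w : ℂ) : weylPoint z * weylPoint w =
    ⟨0, 0, Real.pi * (z.im * w.re - z.re * w.im)⟩ * weylPoint (z + w) := by
  ext
  · simp [weylPoint]
  · simp [weylPoint]
  · simp [weylPoint]
    ring

lemma weylPoint_zero : weylPoint 0 = 1 := by ext <;> simp [weylPoint]

lemma weylPoint_inv (z : ℂ) : (weylPoint z)⁻¹ = weylPoint (-z) := by
  ext
  · simp [weylPoint]
  · simp [weylPoint]
  · simp [weylPoint]
    ring

lemma eq_mul_weylPoint (g : HeisenbergWeyl) :
    g = ⟨0, 0, g.φ + Real.pi * g.τ * g.ν⟩ * weylPoint ⟨g.τ, g.ν⟩ := by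
  ext <;> simp [weylPoint]

lemma continuous_weylPoint : Continuous weylPoint :=
  continuous_mk Complex.continuous_re Complex.continuous_im (by fun_prop)

/-- The Gaussian `e^{-π|z|²/2}`. -/
noncomputable def gauss (z : ℂ) : ℂ := Complex.exp (-(Real.pi / 2 : ℂ) * ‖z‖ ^ 2)

lemma continuous_gauss : Continuous gauss := by unfold gauss; fun_prop

lemma integrable_gauss : Integrable gauss := by
  have h := GaussianFourier.integrable_cexp_neg_mul_sq_norm_add (V := ℂ) (b := (Real.pi / 2 : ℝ))
    (by simpa using Real.pi_pos) 0 0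
  exact h.congr (.of_forall fun z => by simp [gauss])

lemma gauss_neg (z : ℂ) : gauss (-z) = gauss z := by simp [gauss]

lemma gauss_zero : gauss 0 = 1 := by simp [gauss]

lemma conj_gauss (z : ℂ) : starRingEnd ℂ (gauss z) = gauss z := by
  simp [gauss, ← Complex.exp_conj, Complex.conj_ofNat]

lemma ofReal_sq_norm (z : ℂ) : ((‖z‖ : ℝ) : ℂ) ^ 2 = (z.re : ℂ) ^ 2 + (z.im : ℂ) ^ 2 := by
  rw [← Complex.ofReal_pow, Complex.sq_norm, Complex.normSq_apply]
  push_cast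
  ring

/-- The Gaussian integral behind `P W(w) P = e^{-π|w|²/2} P`. -/
lemma integral_gauss_mul_gauss (w y : ℂ) :
    ∫ z, gauss z * gauss (y - (w + z)) * Complex.exp (Complex.I * ((Real.pi *
      (w.im * (y - z).re - w.re * (y - z).im) + Real.pi * (z.im * y.re - z.re * y.im) : ℝ) : ℂ)) =
      gauss w * gauss y := by
  -- Centering completes the square: |z|² + |y - w - z|² = 2|s|² + |y - w|²/2, and the phase is
  -- linear in s.
  rw [← integral_add_right_eq_self _ ((y - w) / 2)]
  have e (s : ℂ) : gauss (s + (y - w) / 2) * gauss (y - (w + (s + (y - w) / 2))) *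
      Complex.exp (Complex.I * ((Real.pi *
        (w.im * (y - (s + (y - w) / 2)).re - w.re * (y - (s + (y - w) / 2)).im) + Real.pi *
        ((s + (y - w) / 2).im * y.re - (s + (y - w) / 2).re * y.im) : ℝ) : ℂ)) =
      Complex.exp (-(Real.pi / 4 : ℂ) * ‖y - w‖ ^ 2) *
        Complex.exp (-(Real.pi : ℂ) * ‖s‖ ^ 2 + (Complex.I * Real.pi) *
          (inner ℝ (Complex.I * (w + y)) s : ℝ)) := by
    simp only [gauss, ← Complex.exp_add]
    congr 1
    simp only [ofReal_sq_norm, Complex.inner]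
    simp
    ring
  simp only [e]
  rw [integral_const_mul, GaussianFourier.integral_cexp_neg_mul_sq_norm_add
    (by simpa using Real.pi_pos), Complex.finrank_real_complex]
  have hpi : (Real.pi : ℂ) ≠ 0 := by exact_mod_cast Real.pi_ne_zero
  rw [div_self hpi, Complex.one_cpow, one_mul, gauss, gauss, ← Complex.exp_add, ← Complex.exp_add]
  congr 1
  -- The Gaussian integral contributes e^{-π|w+y|²/4}; the parallelogram law combines it with
  -- e^{-π|y-w|²/4}.
  have e' : (Complex.I * Real.pi : ℂ) ^ 2 * ‖Complex.I * (w + y)‖ ^ 2 / (4 * Real.pi) =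
      -(Real.pi / 4 : ℂ) * ‖w + y‖ ^ 2 := by
    rw [norm_mul, Complex.norm_I, mul_pow, Complex.I_sq]
    field_simp
  rw [e']
  simp only [ofReal_sq_norm]
  simp
  ring

variable {K : Type*} [NormedAddCommGroup K] [InnerProductSpace ℂ K]
  {π : UnitaryRep HeisenbergWeyl K}

lemma weyl_mul (hπ : HasCentralCharacter π) (z w : ℂ) (v : K) :
    π (weylPoint z) (π (weylPoint w) v) =
      Complex.exp (Complex.I * ((Real.pi * (z.im * w.re - z.re * w.im) : ℝ) : ℂ)) •
        π (weylPoint (z + w)) v := by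
  rw [← UnitaryRep.map_mul_apply, weylPoint_mul, UnitaryRep.map_mul_apply, hπ]

lemma continuous_weyl (π : UnitaryRep HeisenbergWeyl K) (v : K) :
    Continuous fun z => π (weylPoint z) v :=
  (π.strongly_continuous v).comp continuous_weylPoint

lemma integrable_gauss_smul (π : UnitaryRep HeisenbergWeyl K) (v : K) :
    Integrable fun z => gauss z • π (weylPoint z) v := by
  refine (integrable_gauss.norm.mul_const ‖v‖).mono'
    (continuous_gauss.smul (continuous_weyl π v)).aestronglyMeasurable (.of_forall fun z => ?_)
  rw [norm_smul, LinearIsometryEquiv.norm_map]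

/-- The Gaussian average `∫ e^{-π|z|²/2} W(z)v dz`. -/
noncomputable def gaussAverage (π : UnitaryRep HeisenbergWeyl K) (v : K) : K :=
  ∫ z, gauss z • π (weylPoint z) v

variable [CompleteSpace K]

lemma inner_gaussAverage (π : UnitaryRep HeisenbergWeyl K) (u v : K) :
    inner ℂ u (gaussAverage π v) = ∫ z, gauss z * inner ℂ u (π (weylPoint z) v) := by
  rw [gaussAverage, ← integral_inner (integrable_gauss_smul π v)]
  simp only [inner_smul_right]

/-- The adjoint of W(z) is W(-z), and the Gaussian is real and even. -/
lemma inner_gaussAverage_left (π : UnitaryRep HeisenbergWeyl K) (u v : K) :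
    inner ℂ (gaussAverage π u) v = inner ℂ u (gaussAverage π v) := by
  rw [← inner_conj_symm, inner_gaussAverage, inner_gaussAverage, ← integral_conj,
    ← integral_neg_eq_self]
  congr 1
  funext z
  rw [map_mul, conj_gauss, gauss_neg, inner_conj_symm, UnitaryRep.inner_map_left, weylPoint_inv,
    neg_neg]

/-- Up to a phase W(z)W(w)W(z') is W(y) with y = w + z + z'. Taking y as the variable in place of z'
and integrating over z first leaves the scalar integral `integral_gauss_mul_gauss`. -/
lemma gaussAverage_weyl_gaussAverage (hπ : HasCentralCharacter π) (w : ℂ) (v : K) :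
    gaussAverage π (π (weylPoint w) (gaussAverage π v)) = gauss w • gaussAverage π v := by
  let k (z y : ℂ) : ℂ := gauss z * gauss (y - (w + z)) * Complex.exp (Complex.I * ((Real.pi *
    (w.im * (y - z).re - w.re * (y - z).im) + Real.pi * (z.im * y.re - z.re * y.im) : ℝ) : ℂ))
  have hk : Continuous fun p : ℂ × ℂ => k p.2 p.1 := by
    have := continuous_gauss
    fun_prop
  have e1 (z : ℂ) : gauss z • π (weylPoint z) (π (weylPoint w) (gaussAverage π v)) =
      ∫ y, k z y • π (weylPoint y) v := by
    have e : gauss z • π (weylPoint z) (π (weylPoint w) (gaussAverage π v)) =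
        ∫ z', gauss z • π (weylPoint z) (π (weylPoint w) (gauss z' • π (weylPoint z') v)) := by
      rw [integral_smul, LinearIsometryEquiv.integral_comp_comm,
        LinearIsometryEquiv.integral_comp_comm, gaussAverage]
    rw [e, ← integral_sub_right_eq_self _ (w + z)]
    congr 1
    funext y
    have e2 : w.im * (y - (w + z)).re - w.re * (y - (w + z)).im =
        w.im * (y - z).re - w.re * (y - z).im := by
      simp
      ring
    have e3 : z.im * (w + (y - (w + z))).re - z.re * (w + (y - (w + z))).im =
        z.im * y.re - z.re * y.im := by
      simp
      ring
    rw [map_smul, map_smul, weyl_mul hπ w, map_smul, weyl_mul hπ z, smul_smul, smul_smul, smul_smul,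
      e2, e3]
    congr 1
    · simp only [k]
      rw [Complex.ofReal_add, mul_add, Complex.exp_add]
      ring
    · congr 2
      ring_nf
  have hint : Integrable (Function.uncurry fun y z => k z y • π (weylPoint y) v)
      ((volume : Measure ℂ).prod volume) := by
    -- The norm of the integrand is ‖v‖ times the convolution integrand of a Gaussian with a
    -- translated Gaussian.
    have h := (integrable_gauss.norm.convolution_integrand (ContinuousLinearMap.mul ℝ ℝ)
      (integrable_gauss.norm.comp_sub_right w)).mul_const ‖v‖
    refine h.mono' (hk.smul ((continuous_weyl π v).comp continuous_fst)).aestronglyMeasurable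
      (.of_forall fun p => ?_)
    simp only [Function.uncurry, k]
    rw [norm_smul, LinearIsometryEquiv.norm_map, norm_mul, norm_mul, norm_exp_I_mul, mul_one,
      sub_sub, add_comm w, ContinuousLinearMap.mul_apply']
  rw [gaussAverage]
  simp only [e1]
  rw [← integral_integral_swap hint]
  simp only [integral_smul_const]
  simp only [k, integral_gauss_mul_gauss, mul_smul]
  rw [integral_smul]
  rfl

open FourierTransform in
-- Conjugating W(z) by W(iξ) multiplies it by the Fourier character at ξ. If all averages vanished,
-- so would the Fourier transform of e^{-π|z|²/2}⟨u, W(z)u⟩, hence by inversion its value ‖u‖² at 0.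
lemma exists_gaussAverage_ne_zero (hπ : HasCentralCharacter π) {u : K} (hu : u ≠ 0) :
    ∃ v, gaussAverage π v ≠ 0 := by
  by_contra! h0
  let f (z : ℂ) : ℂ := gauss z * inner ℂ u (π (weylPoint z) u)
  have hc : Continuous f := continuous_gauss.mul (continuous_const.inner (continuous_weyl π u))
  have hf : Integrable f := by
    refine (integrable_gauss.norm.mul_const (‖u‖ * ‖u‖)).mono' hc.aestronglyMeasurable
      (.of_forall fun z => ?_)
    rw [norm_mul]
    gcongr
    refine (norm_inner_le_norm _ _).trans ?_
    rw [LinearIsometryEquiv.norm_map]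
  have hF : 𝓕 f = 0 := by
    funext ξ
    have h := inner_gaussAverage π (π (weylPoint (Complex.I * ξ)) u)
      (π (weylPoint (Complex.I * ξ)) u)
    rw [h0, inner_zero_right] at h
    rw [Real.fourier_eq', Pi.zero_apply, h]
    congr 1
    funext z
    rw [UnitaryRep.inner_map_left, weylPoint_inv, weyl_mul hπ z, map_smul,
      weyl_mul hπ, smul_smul,
      inner_smul_right, ← Complex.exp_add, smul_eq_mul]
    have e : -(Complex.I * ξ) + (z + Complex.I * ξ) = z := by ring
    simp only [f, e, Complex.inner]
    rw [mul_left_comm]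
    congr 3
    push_cast
    simp
    ring
  have h := hc.fourierInv_fourier_eq hf (by rw [hF]; exact integrable_zero _ _ _)
  have h' := congrFun h 0
  rw [hF, Real.fourierInv_eq'] at h'
  simp only [Pi.zero_apply, smul_zero, integral_zero, f, gauss_zero, weylPoint_zero,
    UnitaryRep.map_one_apply, one_mul] at h'
  exact hu (inner_self_eq_zero.1 h'.symm)

/-- Every representation with central character `e^{iφ}` has a unit vector whose matrix coefficient
is the Gaussian. -/
lemma exists_gaussian_vector [Nontrivial K] (hπ : HasCentralCharacter π) :
    ∃ Ω : K, Ω ≠ 0 ∧ ∀ g, inner ℂ Ω (π g Ω) =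
      Complex.exp (Complex.I * ((g.φ + Real.pi * g.τ * g.ν : ℝ) : ℂ)) * gauss ⟨g.τ, g.ν⟩ := by
  obtain ⟨u, hu⟩ := exists_ne (0 : K)
  obtain ⟨v, hv⟩ := exists_gaussAverage_ne_zero hπ hu
  have key (w : ℂ) : inner ℂ (gaussAverage π v) (π (weylPoint w) (gaussAverage π v)) =
      gauss w * inner ℂ v (gaussAverage π v) := by
    rw [inner_gaussAverage_left, gaussAverage_weyl_gaussAverage hπ, inner_smul_right]
  -- At w = 0 the unknown factor ⟨v, Pv⟩ is identified as ‖Pv‖², which fixes the normalization.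
  have h0 := key 0
  rw [weylPoint_zero, UnitaryRep.map_one_apply, gauss_zero, one_mul,
    inner_self_eq_norm_sq_to_K] at h0
  have hn : ((‖gaussAverage π v‖ : ℝ) : ℂ) ≠ 0 := by exact_mod_cast norm_ne_zero_iff.2 hv
  refine ⟨(‖gaussAverage π v‖ : ℂ)⁻¹ • gaussAverage π v, smul_ne_zero (inv_ne_zero hn) hv,
    fun g => ?_⟩
  rw [eq_mul_weylPoint g, UnitaryRep.map_mul_apply, hπ, ← eq_mul_weylPoint g, map_smul,
    inner_smul_right, inner_smul_left, inner_smul_right, key, ← h0, map_inv₀, Complex.conj_ofReal]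
  simp only [RCLike.ofReal_eq_complex_ofReal]
  field_simp

/-- The Stone-von Neumann theorem. -/
lemma isEquivalent_schrodinger (hirr : π.IsIrreducible) (hπ : HasCentralCharacter π) :
    π.IsEquivalent schrodinger := by
  have := hirr.1
  have := nontrivial_L2R
  obtain ⟨Ω, hΩ, h⟩ := exists_gaussian_vector hπ
  obtain ⟨Ω', hΩ', h'⟩ := exists_gaussian_vector hasCentralCharacter_schrodinger
  exact hirr.isEquivalent_of_inner_eq isIrreducible_schrodinger hΩ hΩ' fun g => by rw [h, h']

end HeisenbergWeyl

theorem mainTheorem6 :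
    -- the center is `Z = {(0, 0, φ)}`, and `dτ dν dφ` is a left and right Haar measure
    ((Subgroup.center HeisenbergWeyl : Set HeisenbergWeyl) = {g | g.τ = 0 ∧ g.ν = 0} ∧
      HeisenbergWeyl.haar.IsHaarMeasure ∧ HeisenbergWeyl.haar.IsMulRightInvariant) ∧
    -- (i) `ρ` is irreducible with central character `e^{iφ}`, and unique as such
    (HeisenbergWeyl.schrodinger.IsIrreducible ∧
      HeisenbergWeyl.HasCentralCharacter HeisenbergWeyl.schrodinger ∧
      ∀ (K : Type*) [NormedAddCommGroup K] [InnerProductSpace ℂ K] [CompleteSpace K]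
        (π : UnitaryRep HeisenbergWeyl K), π.IsIrreducible →
        HeisenbergWeyl.HasCentralCharacter π → π.IsEquivalent HeisenbergWeyl.schrodinger) ∧
    -- (ii) `ρ` is not square-integrable over `H`
    (¬ HeisenbergWeyl.schrodinger.IsSquareIntegrable HeisenbergWeyl.haar) ∧
    -- (iii) `H ⧸ Z ≅ ℝ²` as topological groups and measure spaces; `ρ` is square-integrable
    -- modulo the center, every nonzero window is admissible, and the Moyal identity holds
    ((∃ e : (HeisenbergWeyl ⧸ Subgroup.center HeisenbergWeyl) ≃ₜ* Multiplicative (ℝ × ℝ),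
        (∀ g : HeisenbergWeyl, e g = Multiplicative.ofAdd (g.τ, g.ν)) ∧
        MeasurePreserving (fun q => (e q).toAdd) HeisenbergWeyl.haarModCenter volume) ∧
      HeisenbergWeyl.schrodinger.IsSquareIntegrableModCenter HeisenbergWeyl.haarModCenter ∧
      (∀ ψ : HeisenbergWeyl.L2R, ψ ≠ 0 →
        HeisenbergWeyl.schrodinger.IsAdmissibleModCenter HeisenbergWeyl.haarModCenter ψ) ∧
      ∀ x ψ : HeisenbergWeyl.L2R,
        Integrable (fun p : ℝ × ℝ => ‖HeisenbergWeyl.stft ψ x p‖ ^ 2) volume ∧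
        ∫ p : ℝ × ℝ, ‖HeisenbergWeyl.stft ψ x p‖ ^ 2 = ‖x‖ ^ 2 * ‖ψ‖ ^ 2) ∧
    -- (iv) `dτ dν` is a left and right Haar measure on `H ⧸ Z`, and the identity operator is the
    -- unique Duflo-Moore operator of `ρ` on `H ⧸ Z`
    (HeisenbergWeyl.haarModCenter.IsHaarMeasure ∧
      HeisenbergWeyl.haarModCenter.IsMulRightInvariant ∧
      ∀ C : HeisenbergWeyl.L2R →ₗ.[ℂ] HeisenbergWeyl.L2R,
        HeisenbergWeyl.schrodinger.IsDufloMooreModCenter HeisenbergWeyl.haarModCenter C ↔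
          C = (LinearMap.id : HeisenbergWeyl.L2R →ₗ[ℂ] HeisenbergWeyl.L2R).toPMap ⊤) := by
  open HeisenbergWeyl in
  exact ⟨⟨coe_center, isHaarMeasure_haar, isMulRightInvariant_haar⟩,
    ⟨isIrreducible_schrodinger, hasCentralCharacter_schrodinger,
      fun _ _ _ _ _ hirr hπ => isEquivalent_schrodinger hirr hπ⟩,
    not_isSquareIntegrable_schrodinger,
    ⟨⟨quotientCenterEquiv, quotientCenterEquiv_coe, measurePreserving_quotientCenterEquiv⟩,
      isSquareIntegrableModCenter_schrodinger,
      fun _ hψ => isAdmissibleModCenter_schrodinger hψ,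
      fun x ψ => ⟨integrable_stft_sq ψ x, integral_stft_sq ψ x⟩⟩,
    isHaarMeasure_haarModCenter, isMulRightInvariant_haarModCenter,
    isDufloMooreModCenter_schrodinger_iff⟩
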